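/- **Hadamard promise problems.** A Hadamard promise problem (HPP) on $n$ gates consists of $n\ge 1$ gate names, pairwise distinct permutations $\Pi_x$ $(x=0,\dots,n_x-1)$ of all $n$ gates, each read as the product of the gates in that order, and a Hadamard matrix $s(x,y)\in\{1,-1\}$ of size $n_x\times n_x$. Unitary gates $U_1,\dots,U_n$ of dimension $d$ satisfy the promise with value $y$ if $\Pi_x=s(x,y)\,\Pi_0$ for all $x$; the task is to find $y$. The basic HPP has two gates $U_0,U_1$, the permutations $\Pi_0=U_1U_0$, $\Pi_1=U_0U_1$, and $s(x,y)=(-1)^{xy}$ with $x,y\in\{0,1\}$ (the gates commute or anticommute). **Substitution.** Given two HPPs with permutations $\Pi^{(1)}_{x_1}$, $\Pi^{(2)}_{x_2}$ and Hadamard matrices $s_1$, $s_2$, and a gate $i$ of the first one, substitution yields the HPP whose gates are those of the first problem other than $i$ together with those of the second, whose permutations $\Pi_{(x_1,x_2)}$ arise from $\Pi^{(1)}_{x_1}$ by replacing the gate $i$ with $\Pi^{(2)}_{x_2}$, with $\Pi_{(0,0)}$ as the distinguished permutation, and whose Hadamard matrix is $s((x_1,x_2),(y_1,y_2))=s_1(x_1,y_1)\,s_2(x_2,y_2)$.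 Let $\mathcal C$ be the smallest class of HPPs that contains the basic HPP and is closed under substitution and under renaming of gates and labels. **Causal algorithms.** A causal quantum algorithm with $d$-dimensional black-box gates is a quantum circuit with a $d$-dimensional target register and a finite-dimensional auxiliary register. It starts in a fixed density matrix and applies a fixed finite sequence of calls, each of one named black-box gate to the target register. Each call is followed by a fixed quantum channel on both registers. It ends with a fixed measurement (POVM) whose outcomes are the possible answers $y$. Its number of calls is the length of the sequence. It solves an HPP if, for all $d$-dimensional unitary gates that satisfy the promise with value $y$, it outputs $y$ with probability $1$. **Lemma.** Let $d\ge 2$ be even (for instance $d=2$, qubit gates). Then every causal quantum algorithm that solves, for $d$-dimensional gates, an HPP in $\mathcal C$ with $n$ gates makes at least $2n-1$ calls to black-box gates. -/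

import Mathlib

open scoped ComplexOrder Kronecker

/-! ### Hadamard promise problems -/

/-- A Hadamard promise problem: a finite non-empty set `Gate` of names of black-box gates, a set of
pairwise distinct permutations `Π_x` of all the gates, indexed by `x : Label` with a distinguished
label `x = 0`, and a Hadamard matrix `s x y` (with integer entries, which are then `1` or `-1`).
The list `perm x` is the product `Π_x` read from left to right, so `[1, 0]` stands for `U₁ U₀`. The possible answers `y` have the same label set. -/
structure HPP where
  Gate : Type
  Label : Type
  [fintypeGate : Fintype Gate]
  [decEqGate : DecidableEq Gate]
  [nonemptyGate : Nonempty Gate]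
  [fintypeLabel : Fintype Label]
  [decEqLabel : DecidableEq Label]
  zero : Label
  perm : Label → List Gate
  perm_nodup : ∀ x, (perm x).Nodup
  mem_perm : ∀ x g, g ∈ perm x
  perm_injective : Function.Injective perm
  s : Matrix Label Label ℤ
  s_hadamard : s.IsHadamard

attribute [instance] HPP.fintypeGate HPP.decEqGate HPP.nonemptyGate HPP.fintypeLabel
  HPP.decEqLabel

namespace HPP

/-- The product `Π_x` of the given `d`-dimensional unitary gates. -/
def product (P : HPP) {d : ℕ} (U : P.Gate → Matrix.unitaryGroup (Fin d) ℂ) (x : P.Label) :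
    Matrix (Fin d) (Fin d) ℂ :=
  (((P.perm x).map U).prod : Matrix.unitaryGroup (Fin d) ℂ)

/-- The gates `U` satisfy the promise with value `y`: `Π_x = s(x,y) Π_0` for all `x`. -/
def Promise (P : HPP) {d : ℕ} (U : P.Gate → Matrix.unitaryGroup (Fin d) ℂ) (y : P.Label) : Prop :=
  ∀ x, P.product U x = (P.s x y : ℂ) • P.product U P.zero

/-- The basic problem: `Π_0 = U₁ U₀`, `Π_1 = U₀ U₁`, `s(x,y) = (-1)^(x y)`. -/
def basic : HPP where
  Gate := Fin 2
  Label := Fin 2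
  zero := 0
  perm x := if x = 0 then [1, 0] else [0, 1]
  perm_nodup := by decide
  mem_perm := by decide
  perm_injective := by decide
  s x y := (-1) ^ (x.val * y.val)
  s_hadamard :=
    { apply_mem := by simp only [Unitary.mem_iff]; decide
      mul_conjTranspose := by decide
      conjTranspose_mul := by decide }

/-- The product `Π_x` of the first problem with the gate `i` replaced by `Π_z` of the second. -/
def substPerm (P Q : HPP) (i : P.Gate) (x : P.Label × Q.Label) :
    List ({j : P.Gate // j ≠ i} ⊕ Q.Gate) :=
  (P.perm x.1).flatMap fun g =>
    if h : g = i then (Q.perm x.2).map Sum.inr else [Sum.inl ⟨g, h⟩]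

theorem substPerm_nodup (P Q : HPP) (i : P.Gate) (x : P.Label × Q.Label) :
    (substPerm P Q i x).Nodup := by
  unfold substPerm
  rw [List.nodup_flatMap]
  refine ⟨fun g _ => ?_, (P.perm_nodup x.1).imp ?_⟩
  · split_ifs
    · exact (Q.perm_nodup x.2).map Sum.inr_injective
    · simp
  · intro a b hab
    by_cases ha : a = i <;> by_cases hb : b = i <;> simp_all [Function.onFun, List.Disjoint]

theorem mem_substPerm (P Q : HPP) (i : P.Gate) (x : P.Label × Q.Label)
    (g : {j : P.Gate // j ≠ i} ⊕ Q.Gate) : g ∈ substPerm P Q i x := by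
  unfold substPerm
  rw [List.mem_flatMap]
  rcases g with ⟨j, hj⟩ | k
  · exact ⟨j, P.mem_perm _ _, by simp [hj]⟩
  · exact ⟨i, P.mem_perm _ _, by simp [Q.mem_perm]⟩

theorem filterMap_inr_substPerm (P Q : HPP) (i : P.Gate) (x : P.Label × Q.Label) :
    (substPerm P Q i x).filterMap Sum.getRight? = Q.perm x.2 := by
  have key : ∀ l : List P.Gate, (l.flatMap fun g =>
      if h : g = i then (Q.perm x.2).map Sum.inr
        else [(Sum.inl ⟨g, h⟩ : {j : P.Gate // j ≠ i} ⊕ Q.Gate)]).filterMap Sum.getRight? =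
      (l.filter (· = i)).flatMap fun _ => Q.perm x.2 := by
    intro l
    induction l with
    | nil => simp
    | cons a l ih =>
      by_cases h : a = i
      · simp only [List.flatMap_cons, List.filterMap_append, ih, h]
        simp [List.filterMap_map, Function.comp_def]
      · simp only [List.flatMap_cons, List.filterMap_append, ih, h]
        simp [h]
  have hl : (P.perm x.1).filter (· = i) = [i] := by
    rw [List.filter_eq, List.count_eq_one_of_mem (P.perm_nodup _) (P.mem_perm _ _)]
    rfl
  rw [substPerm, key, hl]
  simp

theorem filterMap_inl_substPerm (P Q : HPP) (i : P.Gate) (x : P.Label × Q.Label) (k : Q.Gate) :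
    (substPerm P Q i x).filterMap
      (Sum.elim (fun j => some j.1) (fun q => if q = k then some i else none)) = P.perm x.1 := by
  have hk : (Q.perm x.2).filterMap (fun q => if q = k then some i else none) = [i] := by
    have h1 : (Q.perm x.2).filterMap (fun q => if q = k then some i else none) =
        ((Q.perm x.2).filter (· = k)).map fun _ => i := by
      generalize Q.perm x.2 = l
      induction l with
      | nil => rfl
      | cons a l ih => by_cases h : a = k <;> simp [h, ih]
    rw [h1, List.filter_eq, List.count_eq_one_of_mem (Q.perm_nodup _) (Q.mem_perm _ _)]
    rfl
  unfold substPerm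
  generalize P.perm x.1 = l
  induction l with
  | nil => rfl
  | cons a l ih =>
    rw [List.flatMap_cons, List.filterMap_append, ih]
    by_cases h : a = i
    · simp only [h, dite_true, List.filterMap_map]
      have : (Sum.elim (fun j : {j : P.Gate // j ≠ i} => some j.1)
          (fun q => if q = k then some i else none)) ∘ Sum.inr =
          fun q => if q = k then some i else none := rfl
      rw [this, hk]
      rfl
    · simp [h]

theorem substPerm_injective (P Q : HPP) (i : P.Gate) :
    Function.Injective (substPerm P Q i) := by
  intro x z h
  have h2 : x.2 = z.2 := Q.perm_injective <| by
    rw [← filterMap_inr_substPerm P Q i x, h, filterMap_inr_substPerm]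
  obtain ⟨k⟩ := Q.nonemptyGate
  have h1 : x.1 = z.1 := P.perm_injective <| by
    rw [← filterMap_inl_substPerm P Q i x k, h, filterMap_inl_substPerm]
  exact Prod.ext h1 h2

/-- The substitution method: the gate `i` of `P` is replaced by the permutations of `Q`. The new
gates are the gates of `P` other than `i` together with those of `Q`, the new labels are the pairs
`(x₁, x₂)`, with `(0, 0)` as the new `0`, and the new Hadamard matrix has the entries
`s₁(x₁, y₁) s₂(x₂, y₂)`. -/
def subst (P Q : HPP) (i : P.Gate) : HPP where
  Gate := {j : P.Gate // j ≠ i} ⊕ Q.Gate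
  Label := P.Label × Q.Label
  zero := (P.zero, Q.zero)
  perm := substPerm P Q i
  perm_nodup := substPerm_nodup P Q i
  mem_perm := mem_substPerm P Q i
  perm_injective := substPerm_injective P Q i
  s := P.s ⊗ₖ Q.s
  s_hadamard := P.s_hadamard.kronecker Q.s_hadamard

/-- The class of problems generated from the basic problem by the substitution method, closed
under renaming of the gates and of the labels. -/
inductive Generated : HPP → Prop
  | basic : Generated HPP.basic
  | subst (P Q : HPP) (i : P.Gate) : Generated P → Generated Q → Generated (P.subst Q i)
  | rename (P Q : HPP) (g : P.Gate ≃ Q.Gate) (e f : P.Label ≃ Q.Label)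
      (zero_eq : e P.zero = Q.zero)
      (perm_eq : ∀ x, Q.perm (e x) = (P.perm x).map g)
      (s_eq : ∀ x y, Q.s (e x) (f y) = P.s x y) : Generated P → Generated Q

end HPP

/-! ### Causal quantum algorithms -/

/-- A quantum channel on the complex matrices indexed by `n`, given by Kraus operators. -/
structure QChannel (n : Type) [Fintype n] [DecidableEq n] where
  rank : ℕ
  kraus : Fin rank → Matrix n n ℂ
  trace_preserving : ∑ r, (kraus r).conjTranspose * kraus r = 1

/-- The action `ρ ↦ ∑ K ρ K†` of a channel on states. -/
def QChannel.act {n : Type} [Fintype n] [DecidableEq n] (Φ : QChannel n) (ρ : Matrix n n ℂ) :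
    Matrix n n ℂ :=
  ∑ r, Φ.kraus r * ρ * (Φ.kraus r).conjTranspose

/-- A causal quantum algorithm (a quantum circuit) with black-box gates named by `G` that act on a
`d`-dimensional system, and with outcomes in `Y`. It has a `d`-dimensional target register and an
arbitrary finite-dimensional auxiliary register, and starts in a fixed density matrix. Then
it runs through a fixed list of steps: the step `(g, Φ)` applies the black-box gate `g` to the
target register and after that the fixed channel `Φ` to both registers (in particular any
unitary, swap of the target with an auxiliary system, or intermediate measurement whose result is
kept in the auxiliary register). It ends with a measurement (POVM) with outcomes in `Y`. -/
structure CausalAlgorithm (G Y : Type) [Fintype Y] (d : ℕ) where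
  aux : ℕ
  start : Matrix (Fin d × Fin aux) (Fin d × Fin aux) ℂ
  start_posSemidef : start.PosSemidef
  start_trace : start.trace = 1
  steps : List (G × QChannel (Fin d × Fin aux))
  povm : Y → Matrix (Fin d × Fin aux) (Fin d × Fin aux) ℂ
  povm_posSemidef : ∀ y, (povm y).PosSemidef
  povm_sum : ∑ y, povm y = 1

namespace CausalAlgorithm

variable {G Y : Type} [Fintype Y] {d : ℕ}

/-- The total number of calls to black-box gates. -/
def numCalls (A : CausalAlgorithm G Y d) : ℕ := A.steps.length

/-- The gate `U` on the target register and the identity on the auxiliary register. -/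
def callGate (a : ℕ) (U : Matrix.unitaryGroup (Fin d) ℂ) :
    Matrix (Fin d × Fin a) (Fin d × Fin a) ℂ :=
  (U : Matrix (Fin d) (Fin d) ℂ) ⊗ₖ (1 : Matrix (Fin a) (Fin a) ℂ)

/-- The state at the end of the circuit, before the measurement. -/
def finalState (A : CausalAlgorithm G Y d) (U : G → Matrix.unitaryGroup (Fin d) ℂ) :
    Matrix (Fin d × Fin A.aux) (Fin d × Fin A.aux) ℂ :=
  A.steps.foldl
    (fun ρ t => t.2.act (callGate A.aux (U t.1) * ρ * (callGate A.aux (U t.1)).conjTranspose))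
    A.start

/-- The probability of the outcome `y` when the black-box gates are `U`. -/
def outcomeProb (A : CausalAlgorithm G Y d) (U : G → Matrix.unitaryGroup (Fin d) ℂ) (y : Y) : ℝ :=
  (A.povm y * A.finalState U).trace.re

end CausalAlgorithm

/-- The algorithm solves the problem `P` for `d`-dimensional gates: for all unitary gates that
satisfy the promise with the value `y`, it outputs `y` with certainty. -/
def CausalAlgorithm.Solves {d : ℕ} (P : HPP) (A : CausalAlgorithm P.Gate P.Label d) : Prop :=
  ∀ (U : P.Gate → Matrix.unitaryGroup (Fin d) ℂ) (y : P.Label),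
    P.Promise U y → A.outcomeProb U y = 1

/-!
Two facts bound the calls of an algorithm from below: every gate is called at least once, and no two
distinct gates are both called exactly once. So all gates but at most one are called twice or
more, which makes `2 n - 1` calls.

Both facts come from restricting to gates that are the identity except at two places `i ≠ j`. If
`U i` and `U j` commute, all the products `Π_x` agree, so an answer `y₀` whose signs are all `1` is
correct. If they anticommute, there is another correct answer `y`, the one with a single non-zero bit
at the substitution where `i` and `j` meet
(`HPP.Generated.exists_detectsAnticommute`). Hence the algorithm distinguishes
commuting from anticommuting pairs. It must then call `i`, since a pair `(1, Y)` commutes while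
`(X, Y)` anticommutes for suitable `X` and `Y`.

Suppose `i` and `j` are called once each, say `U` first and then `V`. The steps with
trivial gates merge into channels. On each Kraus branch the final amplitude
`w(U, V) = K₂ V K₁ U B` is bilinear in `U` and `V`. It is in the kernel of the measurement operator `E`
for the answer `y` if `U`, `V` commute, and in the kernel of `1 - E` if they anticommute. In even
dimension there are anticommuting self-adjoint unitaries `X`, `Y`, and then `(X + Y) / √2` is unitary.
From the commuting pairs with `U = V` one gets
`E (w(X, Y) + w(Y, X)) = 0`. As `(X, Y)` and `(Y, X)` anticommute, `w(X, Y) + w(Y, X) = 0`. The channel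
after the second call does not lose this relation, so `Y K₁ X B + X K₁ Y B = 0`, that is,
`K₁ X B = - Y X K₁ Y B`. This is where the causal order enters: the relation survives a change of the
second gate. It says `w(X, 1) = - w(Y, Y X)`, where `(X, 1)` commutes and `(Y, Y X)` anticommutes.
So this amplitude vanishes on every branch, which contradicts the normalization
(`twoCall_not_discriminating`).
-/

/-! ### Promises with two non-trivial gates -/

/-- Scaling one factor of a product in which every factor occurs once scales the product. -/
theorem List.prod_map_eq_smul_of_nodup {ι R M : Type*} [DecidableEq ι] [Semiring R] [Monoid M]
    [SMul M R] [IsScalarTower M R R] [SMulCommClass M R R]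
    {f f' : ι → R} {i : ι} {c : M} (hi : f' i = c • f i) (hne : ∀ j, j ≠ i → f' j = f j)
    {l : List ι} (hl : l.Nodup) (hil : i ∈ l) : (l.map f').prod = c • (l.map f).prod := by
  induction l with
  | nil => simp at hil
  | cons a l ih =>
    rw [List.nodup_cons] at hl
    rw [List.map_cons, List.map_cons, List.prod_cons, List.prod_cons]
    by_cases h : a = i
    · subst h
      have : l.map f' = l.map f :=
        List.map_congr_left fun j hj => hne j fun e => hl.1 (e ▸ hj)
      rw [this, hi, smul_mul_assoc]
    · rw [hne a h, ih hl.2 (List.mem_of_ne_of_mem (Ne.symm h) hil), mul_smul_comm]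

namespace HPP

theorem product_eq (P : HPP) {d : ℕ} (U : P.Gate → Matrix.unitaryGroup (Fin d) ℂ) (x : P.Label) :
    P.product U x = ((P.perm x).map fun g => (U g : Matrix (Fin d) (Fin d) ℂ)).prod := by
  rw [product, Submonoid.coe_list_prod, List.map_map]
  rfl

/-- A label with only positive signs is a correct answer for commuting gates. -/
theorem promise_of_commute {P : HPP} {d : ℕ} {U : P.Gate → Matrix.unitaryGroup (Fin d) ℂ}
    {y : P.Label} (hy : ∀ x, P.s x y = 1) (hU : ∀ g h, Commute (U g) (U h)) : P.Promise U y := by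
  intro x
  have hp : (P.perm x).Perm (P.perm P.zero) :=
    (List.perm_ext_iff_of_nodup (P.perm_nodup _) (P.perm_nodup _)).2
      fun g => ⟨fun _ => P.mem_perm _ g, fun _ => P.mem_perm _ g⟩
  have := (hp.map U).prod_eq' (List.pairwise_map.2 (List.pairwise_of_forall fun g h => hU g h))
  rw [hy, product, product, this]
  simp

/-- The gates of `P` obtained from gates of `P.subst Q i`, where the gate `i` is implemented by the
product `Π_x` of `Q`. -/
def collapse (P Q : HPP) (i : P.Gate) {M : Type*} [Monoid M] (x : Q.Label)
    (U : {j : P.Gate // j ≠ i} ⊕ Q.Gate → M) (g : P.Gate) : M :=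
  if h : g = i then ((Q.perm x).map fun k => U (Sum.inr k)).prod else U (Sum.inl ⟨g, h⟩)

theorem prod_map_substPerm (P Q : HPP) (i : P.Gate) {M : Type*} [Monoid M]
    (U : {j : P.Gate // j ≠ i} ⊕ Q.Gate → M) (x : P.Label × Q.Label) :
    ((substPerm P Q i x).map U).prod = ((P.perm x.1).map (collapse P Q i x.2 U)).prod := by
  unfold substPerm
  generalize P.perm x.1 = l
  induction l with
  | nil => rfl
  | cons a l ih =>
    rw [List.flatMap_cons, List.map_append, List.prod_append, ih, List.map_cons, List.prod_cons]
    congr 1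
    by_cases h : a = i
    · simp [h, collapse, Function.comp_def]
    · simp [h, collapse]

theorem promise_subst {P Q : HPP} {i : P.Gate} {d : ℕ}
    {U : (P.subst Q i).Gate → Matrix.unitaryGroup (Fin d) ℂ} {y₁ : P.Label} {y₂ : Q.Label}
    (hP : P.Promise (collapse P Q i Q.zero U) y₁) (hQ : Q.Promise (fun k => U (Sum.inr k)) y₂) :
    (P.subst Q i).Promise U (y₁, y₂) := by
  have key : ∀ x : P.Label × Q.Label, (P.subst Q i).product U x =
      P.product (collapse P Q i x.2 U) x.1 := fun x =>
    congrArg Subtype.val (prod_map_substPerm P Q i U x)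
  rintro ⟨x₁, x₂⟩
  have h2 : P.product (collapse P Q i x₂ U) x₁ =
      (Q.s x₂ y₂ : ℂ) • P.product (collapse P Q i Q.zero U) x₁ := by
    rw [product_eq, product_eq]
    refine List.prod_map_eq_smul_of_nodup (i := i) ?_ ?_ (P.perm_nodup _) (P.mem_perm _ _)
    · have h := hQ x₂
      rw [product, product] at h
      simpa only [collapse, dite_true] using h
    · intro j hj
      simp [collapse, hj]
  rw [key, h2, hP x₁, show (P.subst Q i).zero = (P.zero, Q.zero) from rfl, key, smul_smul]
  congr 1
  simp [subst, mul_comm]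

/-- All gates other than `i` and `j` are the identity. -/
def TrivialOff {G M : Type*} [One M] (U : G → M) (i j : G) : Prop :=
  ∀ k, k ≠ i → k ≠ j → U k = 1

/-- The label `y` is a correct answer whenever the gates `i` and `j` anticommute and all
other gates are the identity. -/
def DetectsAnticommute (P : HPP) (d : ℕ) (i j : P.Gate) (y : P.Label) : Prop :=
  ∀ U : P.Gate → Matrix.unitaryGroup (Fin d) ℂ, TrivialOff U i j →
    (U i : Matrix (Fin d) (Fin d) ℂ) * U j = -(U j * U i) → P.Promise U y

theorem DetectsAnticommute.symm {P : HPP} {d : ℕ} {i j : P.Gate} {y : P.Label}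
    (h : P.DetectsAnticommute d i j y) : P.DetectsAnticommute d j i y :=
  fun U hU hij => h U (fun k hi hj => hU k hj hi) (by rw [hij, neg_neg])

theorem TrivialOff.commute {G M : Type*} [Monoid M] {U : G → M} {i j : G}
    (hU : TrivialOff U i j) (hij : Commute (U i) (U j)) (g h : G) : Commute (U g) (U h) := by
  have key : ∀ k, U k = U i ∨ U k = U j ∨ U k = 1 := by
    intro k
    by_cases h1 : k = i
    · simp [h1]
    by_cases h2 : k = j
    · simp [h2]
    exact Or.inr (Or.inr (hU k h1 h2))
  rcases key g with e | e | e <;> rcases key h with e' | e' | e' <;> rw [e, e'] <;>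
    first | exact Commute.refl _ | exact hij | exact hij.symm | exact Commute.one_left _ |
      exact Commute.one_right _

theorem prod_map_eq_of_trivial {G M : Type*} [DecidableEq G] [Monoid M] {U : G → M} {i : G}
    (hU : ∀ k, k ≠ i → U k = 1) {l : List G} (hl : l.Nodup) (hi : i ∈ l) :
    (l.map U).prod = U i := by
  induction l with
  | nil => simp at hi
  | cons a l ih =>
    rw [List.nodup_cons] at hl
    rw [List.map_cons, List.prod_cons]
    by_cases h : a = i
    · subst h
      rw [List.prod_eq_one, mul_one]
      simp only [List.mem_map, forall_exists_index, and_imp, forall_apply_eq_imp_iff₂]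
      exact fun k hk => hU k fun e => hl.1 (e ▸ hk)
    · rw [hU a h, one_mul, ih hl.2 (List.mem_of_ne_of_mem (Ne.symm h) hi)]

theorem basic_detectsAnticommute (d : ℕ) : basic.DetectsAnticommute d (0 : Fin 2) (1 : Fin 2)
    (1 : Fin 2) := by
  intro U _ h
  have two : ∀ (x : basic.Label) (i j : basic.Gate), basic.perm x = [i, j] →
      basic.product U x = (U i : Matrix (Fin d) (Fin d) ℂ) * U j := fun x i j hx => by
    rw [product_eq, hx]
    simp
  have key : ∀ x : Fin 2, basic.product U x = (basic.s x (1 : Fin 2) : ℂ) •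
      basic.product U basic.zero := by
    intro x
    obtain rfl | rfl : x = 0 ∨ x = 1 := by omega
    · have : basic.s (0 : Fin 2) (1 : Fin 2) = 1 := rfl
      rw [this, Int.cast_one, one_smul]
      rfl
    · have hs : basic.s (1 : Fin 2) (1 : Fin 2) = -1 := rfl
      rw [hs, two (1 : Fin 2) (0 : Fin 2) (1 : Fin 2) rfl,
        two basic.zero (1 : Fin 2) (0 : Fin 2) rfl, Int.cast_neg, Int.cast_one, neg_one_smul]
      exact h
  exact key

/-- In a generated problem some answer `y₀` has only positive signs, and any two gates can be
singled out: with all other gates equal to the identity, another answer is correct when the two gates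
anticommute. In the tree of substitutions, this is the answer with the single non-zero bit at the
node where the two gates meet. -/
theorem Generated.exists_detectsAnticommute {P : HPP} (hP : P.Generated) (d : ℕ) :
    ∃ y₀, (∀ x, P.s x y₀ = 1) ∧
      ∀ i j, i ≠ j → ∃ y, y ≠ y₀ ∧ P.DetectsAnticommute d i j y := by
  induction hP with
  | basic =>
    refine ⟨(0 : Fin 2), by decide, fun i j hij =>
      ⟨(1 : Fin 2), show (1 : Fin 2) ≠ 0 by decide, ?_⟩⟩
    change Fin 2 at i j
    fin_cases i <;> fin_cases j
    · exact absurd rfl hij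
    · exact basic_detectsAnticommute d
    · exact (basic_detectsAnticommute d).symm
    · exact absurd rfl hij
  | subst P Q i _ _ ihP ihQ =>
    obtain ⟨p₀, hp₀, hP⟩ := ihP
    obtain ⟨q₀, hq₀, hQ⟩ := ihQ
    -- gates on both sides of a substitution meet where the gate `i` was
    have mixed : ∀ (j : {j : P.Gate // j ≠ i}) (k : Q.Gate), ∃ y, y ≠ (p₀, q₀) ∧
        (P.subst Q i).DetectsAnticommute d (Sum.inl j) (Sum.inr k) y := by
      intro j k
      obtain ⟨y, hy, hd⟩ := hP j i j.2
      refine ⟨(y, q₀), by simp [hy], fun U hU h => ?_⟩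
      have hQt : ∀ m, m ≠ k → U (Sum.inr m) = 1 := fun m hm =>
        hU _ Sum.inr_ne_inl fun e => hm (Sum.inr_injective e)
      have hi : collapse P Q i Q.zero U i = U (Sum.inr k) := by
        simp only [collapse, dite_true]
        exact prod_map_eq_of_trivial (U := fun m => U (Sum.inr m)) hQt (Q.perm_nodup _)
          (Q.mem_perm _ _)
      have hj : collapse P Q i Q.zero U j = U (Sum.inl j) := by
        simp [collapse, j.2]
      refine promise_subst (hd _ ?_ ?_) (promise_of_commute hq₀ ?_)
      · intro m hmj hmi
        simp only [collapse, hmi, dite_false]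
        exact hU _ (fun e => hmj (by rw [← Sum.inl_injective e])) Sum.inl_ne_inr
      · rw [hi, hj]
        exact h
      · exact TrivialOff.commute (i := k) (j := k) (fun m hm _ => hQt m hm) (Commute.refl _)
    refine ⟨(p₀, q₀), fun x => ?_, ?_⟩
    · change P.s x.1 p₀ * Q.s x.2 q₀ = 1
      rw [hp₀, hq₀, mul_one]
    · rintro (j | j) (k | k) hjk
      · have hjk' : (j : P.Gate) ≠ k := fun e => hjk (by rw [Subtype.ext e])
        obtain ⟨y, hy, hd⟩ := hP j k hjk'
        refine ⟨(y, q₀), fun e => hy (congrArg Prod.fst e), fun U hU h => ?_⟩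
        have hQt : ∀ m, U (Sum.inr m) = 1 := fun m => hU _ Sum.inr_ne_inl Sum.inr_ne_inl
        refine promise_subst (hd _ ?_ ?_) (promise_of_commute hq₀ ?_)
        · intro m hmj hmk
          by_cases hm : m = i
          · simp [collapse, hm, hQt]
          · simp only [collapse, hm, dite_false]
            exact hU _ (fun e => hmj (by rw [← Sum.inl_injective e]))
              (fun e => hmk (by rw [← Sum.inl_injective e]))
        · simpa [collapse, j.2, k.2] using h
        · intro g h
          rw [hQt g]
          exact Commute.one_left _
      · exact mixed j k
      · obtain ⟨y, hy, hd⟩ := mixed k j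
        exact ⟨y, hy, hd.symm⟩
      · obtain ⟨y, hy, hd⟩ := hQ j k fun e => hjk (by rw [e])
        refine ⟨(p₀, y), fun e => hy (congrArg Prod.snd e), fun U hU h => ?_⟩
        refine promise_subst (promise_of_commute hp₀ ?_) (hd _ ?_ h)
        · refine TrivialOff.commute (i := i) (j := i) (fun m hm _ => ?_) (Commute.refl _)
          simp only [collapse, hm, dite_false]
          exact hU _ Sum.inl_ne_inr Sum.inl_ne_inr
        · exact fun m hj hk => hU _ (fun e => hj (Sum.inr_injective e))
            fun e => hk (Sum.inr_injective e)
  | rename P Q g e f zero_eq perm_eq s_eq _ ih =>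
    obtain ⟨y₀, hy₀, h⟩ := ih
    refine ⟨f y₀, fun x => ?_, fun i j hij => ?_⟩
    · rw [← e.apply_symm_apply x, s_eq, hy₀]
    · obtain ⟨y, hy, hd⟩ := h (g.symm i) (g.symm j) (g.symm.injective.ne hij)
      refine ⟨f y, f.injective.ne hy, fun U hU ha => ?_⟩
      have hp := hd (fun k => U (g k))
        (fun k hi hj => hU _ (fun e => hi (by rw [← e, g.symm_apply_apply]))
          fun e => hj (by rw [← e, g.symm_apply_apply])) (by simpa using ha)
      have key : ∀ x, Q.product U (e x) = P.product (fun k => U (g k)) x := fun x => by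
        rw [product_eq, product_eq, perm_eq, List.map_map]
        rfl
      intro x
      rw [← e.apply_symm_apply x, s_eq, key, ← zero_eq, key]
      exact hp _

theorem Generated.exists_ne {P : HPP} (hP : P.Generated) (i : P.Gate) : ∃ j, j ≠ i := by
  have key : 1 < Fintype.card P.Gate := by
    clear i
    induction hP with
    | basic => decide
    | subst P Q i _ _ ihP ihQ =>
      change 1 < Fintype.card ({j : P.Gate // j ≠ i} ⊕ Q.Gate)
      rw [Fintype.card_sum]
      omega
    | rename P Q g _ _ _ _ _ _ ih => rwa [← Fintype.card_congr g]
  have := Fintype.one_lt_card_iff_nontrivial.1 key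
  exact _root_.exists_ne i

end HPP

/-! ### Channels -/

section Matrices

variable {N : Type} [Fintype N] [DecidableEq N]

open scoped MatrixOrder in
theorem Matrix.PosSemidef.exists_eq_conjTranspose_mul_self {E : Matrix N N ℂ}
    (hE : E.PosSemidef) : ∃ L : Matrix N N ℂ, E = L.conjTranspose * L :=
  CStarAlgebra.nonneg_iff_eq_star_mul_self.1 hE.nonneg

theorem Matrix.PosSemidef.trace_mul_nonneg {E ρ : Matrix N N ℂ} (hE : E.PosSemidef)
    (hρ : ρ.PosSemidef) : 0 ≤ (E * ρ).trace.re := by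
  obtain ⟨L, rfl⟩ := hE.exists_eq_conjTranspose_mul_self
  rw [Matrix.mul_assoc, Matrix.trace_mul_comm]
  exact (Complex.le_def.1 (hρ.mul_mul_conjTranspose_same L).trace_nonneg).1

/-- A measurement operator with probability `0` on a mixture annihilates every component. -/
theorem Matrix.PosSemidef.mul_eq_zero_of_trace_sum {κ : Type*} [Fintype κ] {E : Matrix N N ℂ}
    (hE : E.PosSemidef) {w : κ → Matrix N N ℂ}
    (h : (E * ∑ k, w k * (w k).conjTranspose).trace.re = 0) (k : κ) : E * w k = 0 := by
  have h0 : ∀ k, 0 ≤ (E * (w k * (w k).conjTranspose)).trace.re := fun k =>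
    hE.trace_mul_nonneg (Matrix.posSemidef_self_mul_conjTranspose _)
  rw [Matrix.mul_sum, Matrix.trace_sum, Complex.re_sum,
    Finset.sum_eq_zero_iff_of_nonneg fun k _ => h0 k] at h
  have hk := h k (Finset.mem_univ k)
  obtain ⟨L, rfl⟩ := hE.exists_eq_conjTranspose_mul_self
  have e : (L.conjTranspose * L * (w k * (w k).conjTranspose)).trace =
      ((L * w k) * (L * w k).conjTranspose).trace := by
    rw [Matrix.mul_assoc, Matrix.trace_mul_comm, Matrix.conjTranspose_mul]
    simp only [Matrix.mul_assoc]
  rw [e] at hk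
  have hp := (Matrix.posSemidef_self_mul_conjTranspose (L * w k)).trace_nonneg
  have hz : ((L * w k) * (L * w k).conjTranspose).trace = 0 :=
    Complex.ext hk (Complex.le_def.1 hp).2.symm
  rw [Matrix.mul_assoc, Matrix.trace_mul_conjTranspose_self_eq_zero_iff.1 hz, Matrix.mul_zero]

namespace QChannel

theorem posSemidef_act (Φ : QChannel N) {ρ : Matrix N N ℂ} (hρ : ρ.PosSemidef) :
    (Φ.act ρ).PosSemidef :=
  Matrix.posSemidef_sum _ fun r _ => hρ.mul_mul_conjTranspose_same (Φ.kraus r)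

theorem trace_act (Φ : QChannel N) (ρ : Matrix N N ℂ) : (Φ.act ρ).trace = ρ.trace := by
  have : ∀ r, (Φ.kraus r * ρ * (Φ.kraus r).conjTranspose).trace =
      ((Φ.kraus r).conjTranspose * Φ.kraus r * ρ).trace := fun r => by
    rw [Matrix.trace_mul_comm, Matrix.mul_assoc]
  rw [act, Matrix.trace_sum, Finset.sum_congr rfl fun r _ => this r, ← Matrix.trace_sum,
    ← Finset.sum_mul, Φ.trace_preserving, Matrix.one_mul]

/-- The Kraus operators of a channel have no common kernel. -/
theorem eq_zero_of_kraus_mul (Φ : QChannel N) {M : Matrix N N ℂ}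
    (h : ∀ r, Φ.kraus r * M = 0) : M = 0 := by
  rw [← Matrix.one_mul M, ← Φ.trace_preserving, Finset.sum_mul]
  exact Finset.sum_eq_zero fun r _ => by rw [Matrix.mul_assoc, h, Matrix.mul_zero]

/-- The identity channel. -/
def idChannel (N : Type) [Fintype N] [DecidableEq N] : QChannel N where
  rank := 1
  kraus _ := 1
  trace_preserving := by simp

theorem act_idChannel (ρ : Matrix N N ℂ) : (idChannel N).act ρ = ρ := by
  change ∑ _r : Fin 1, (1 : Matrix N N ℂ) * ρ * (1 : Matrix N N ℂ).conjTranspose = ρ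
  simp

/-- The channel `Φ` followed by the channel `Ψ`. -/
def comp (Ψ Φ : QChannel N) : QChannel N where
  rank := Ψ.rank * Φ.rank
  kraus r := Ψ.kraus (finProdFinEquiv.symm r).1 * Φ.kraus (finProdFinEquiv.symm r).2
  trace_preserving := by
    rw [finProdFinEquiv.symm.sum_comp fun p =>
      (Ψ.kraus p.1 * Φ.kraus p.2).conjTranspose * (Ψ.kraus p.1 * Φ.kraus p.2),
      Fintype.sum_prod_type_right]
    conv_rhs => rw [← Φ.trace_preserving]
    refine Finset.sum_congr rfl fun s _ => ?_
    calc ∑ r, (Ψ.kraus r * Φ.kraus s).conjTranspose * (Ψ.kraus r * Φ.kraus s)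
        = (Φ.kraus s).conjTranspose * ((∑ r, (Ψ.kraus r).conjTranspose * Ψ.kraus r) *
            Φ.kraus s) := by
          rw [Finset.sum_mul, Finset.mul_sum]
          simp only [Matrix.conjTranspose_mul, Matrix.mul_assoc]
      _ = (Φ.kraus s).conjTranspose * Φ.kraus s := by rw [Ψ.trace_preserving, Matrix.one_mul]

theorem act_comp (Ψ Φ : QChannel N) (ρ : Matrix N N ℂ) :
    (Ψ.comp Φ).act ρ = Ψ.act (Φ.act ρ) := by
  unfold act comp
  rw [finProdFinEquiv.symm.sum_comp fun p : Fin Ψ.rank × Fin Φ.rank =>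
    (Ψ.kraus p.1 * Φ.kraus p.2) * ρ * (Ψ.kraus p.1 * Φ.kraus p.2).conjTranspose,
    Fintype.sum_prod_type]
  refine Finset.sum_congr rfl fun r _ => ?_
  rw [Finset.mul_sum, Finset.sum_mul]
  simp only [Matrix.conjTranspose_mul, Matrix.mul_assoc]

end QChannel

/-! ### One call to each of two gates -/

/-- The final state of a circuit that starts in `ρ` and calls `U` and then `V` once each, with the
channel `Φ` after the first and the channel `Ψ` after the second call. -/
def twoCall (Φ Ψ : QChannel N) (ρ U V : Matrix N N ℂ) : Matrix N N ℂ :=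
  Ψ.act (V * Φ.act (U * ρ * U.conjTranspose) * V.conjTranspose)

/-- The unnormalized amplitude of `twoCall` on the Kraus branch `p`, where `B * Bᴴ` is the initial
state. It is bilinear in the two gates. -/
def twoCallAmp (Φ Ψ : QChannel N) (B U V : Matrix N N ℂ) (p : Fin Φ.rank × Fin Ψ.rank) :
    Matrix N N ℂ :=
  Ψ.kraus p.2 * (V * (Φ.kraus p.1 * (U * B)))

theorem twoCall_eq_sum (Φ Ψ : QChannel N) (B U V : Matrix N N ℂ) :
    twoCall Φ Ψ (B * B.conjTranspose) U V =
      ∑ p, twoCallAmp Φ Ψ B U V p * (twoCallAmp Φ Ψ B U V p).conjTranspose := by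
  rw [Fintype.sum_prod_type_right]
  unfold twoCall twoCallAmp QChannel.act
  refine Finset.sum_congr rfl fun s _ => ?_
  rw [Finset.mul_sum, Finset.sum_mul, Finset.mul_sum, Finset.sum_mul]
  simp only [Matrix.conjTranspose_mul, Matrix.mul_assoc]

/-- A circuit that calls `U` and then `V` once each cannot tell commuting from anticommuting
gates. Here `E` is the measurement operator for the answer "anticommuting", the pairs in `comm` and
`anti` are those for which this answer must have probability `0` and `1`, and `H` stands for the
unitary multiple of `X + Y`. -/
theorem twoCall_not_discriminating (Φ Ψ : QChannel N) {ρ E X Y H : Matrix N N ℂ} {c : ℂ}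
    (hρ : ρ.PosSemidef) (hρ0 : ρ ≠ 0) (hE : E.PosSemidef) (hE' : (1 - E).PosSemidef)
    (hX : X * X = 1) (hY : Y * Y = 1) (hc : c ≠ 0)
    (hH : H = c • (X + Y))
    (comm : ∀ p ∈ [(X, X), (Y, Y), (H, H), (X, 1)],
      (E * twoCall Φ Ψ ρ p.1 p.2).trace.re = 0)
    (anti : ∀ p ∈ [(X, Y), (Y, X), (Y, Y * X)],
      ((1 - E) * twoCall Φ Ψ ρ p.1 p.2).trace.re = 0) : False := by
  obtain ⟨L, hL⟩ := hρ.exists_eq_conjTranspose_mul_self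
  obtain ⟨B, rfl⟩ : ∃ B : Matrix N N ℂ, ρ = B * B.conjTranspose :=
    ⟨L.conjTranspose, by rw [hL, Matrix.conjTranspose_conjTranspose]⟩
  simp only [twoCall_eq_sum] at comm anti
  simp only [List.mem_cons, List.not_mem_nil, or_false, forall_eq_or_imp, forall_eq] at comm anti
  obtain ⟨cXX, cYY, cHH, cX1⟩ := comm
  obtain ⟨aXY, aYX, aYZ⟩ := anti
  replace cXX := hE.mul_eq_zero_of_trace_sum cXX
  replace cYY := hE.mul_eq_zero_of_trace_sum cYY
  replace cHH := hE.mul_eq_zero_of_trace_sum cHH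
  replace cX1 := hE.mul_eq_zero_of_trace_sum cX1
  replace aXY := hE'.mul_eq_zero_of_trace_sum aXY
  replace aYX := hE'.mul_eq_zero_of_trace_sum aYX
  replace aYZ := hE'.mul_eq_zero_of_trace_sum aYZ
  -- a vector in the kernels of `E` and of `1 - E` vanishes
  have split : ∀ M : Matrix N N ℂ, E * M = 0 → (1 - E) * M = 0 → M = 0 := fun M h h' => by
    rwa [sub_mul, h, sub_zero, Matrix.one_mul] at h'
  -- bilinearity: the amplitudes of `(X, X)`, `(Y, Y)` and `(X + Y, X + Y)` determine this sum
  have hsum : ∀ p, twoCallAmp Φ Ψ B X Y p + twoCallAmp Φ Ψ B Y X p = 0 := by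
    intro p
    refine split _ ?_ (by rw [mul_add, aXY, aYX, add_zero])
    have e : twoCallAmp Φ Ψ B H H p = (c * c) • (twoCallAmp Φ Ψ B X X p +
        twoCallAmp Φ Ψ B Y Y p + (twoCallAmp Φ Ψ B X Y p + twoCallAmp Φ Ψ B Y X p)) := by
      subst hH
      simp only [twoCallAmp, Matrix.smul_mul, Matrix.mul_smul, Matrix.add_mul, Matrix.mul_add,
        smul_add, smul_smul]
      abel
    have h := cHH p
    rw [e, Matrix.mul_smul, smul_eq_zero_iff_right (mul_ne_zero hc hc), mul_add, mul_add, cXX,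
      cYY, add_zero, zero_add] at h
    exact h
  -- the channel after the second call is injective on amplitudes
  have hmid : ∀ r, Y * (Φ.kraus r * (X * B)) + X * (Φ.kraus r * (Y * B)) = 0 := fun r =>
    Ψ.eq_zero_of_kraus_mul fun s => by
      rw [mul_add]
      exact hsum (r, s)
  have hrel : ∀ r, Φ.kraus r * (X * B) = -((Y * X) * (Φ.kraus r * (Y * B))) := fun r => by
    have h := congrArg (Y * ·) (hmid r)
    simp only [mul_add, ← Matrix.mul_assoc, hY, Matrix.mul_zero, Matrix.one_mul] at h
    simp only [Matrix.mul_assoc] at h ⊢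
    exact eq_neg_of_add_eq_zero_left h
  -- the commuting pair `(X, 1)` and the anticommuting pair `(Y, Y * X)` give the same state
  have hXB : X * B = 0 := Φ.eq_zero_of_kraus_mul fun r => Ψ.eq_zero_of_kraus_mul fun s => by
    refine split _ (by simpa [twoCallAmp] using cX1 (r, s)) ?_
    rw [hrel, Matrix.mul_neg, Matrix.mul_neg, neg_eq_zero]
    exact aYZ (r, s)
  have hB : B = 0 := by
    rw [← Matrix.one_mul B, ← hX, Matrix.mul_assoc, hXB, Matrix.mul_zero]
  exact hρ0 (by rw [hB, Matrix.zero_mul])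

end Matrices

/-! ### Anticommuting unitaries in even dimension -/

theorem exists_anticommuting_unitaries {d : ℕ} (hd : Even d) :
    ∃ X Y H : Matrix.unitaryGroup (Fin d) ℂ, ∃ c : ℂ, c ≠ 0 ∧ X * X = 1 ∧ Y * Y = 1 ∧
      (X : Matrix (Fin d) (Fin d) ℂ) * Y = -(Y * X) ∧
      (H : Matrix (Fin d) (Fin d) ℂ) = c • ((X : Matrix (Fin d) (Fin d) ℂ) + Y) := by
  obtain ⟨m, rfl⟩ := hd
  let e : Matrix (Fin m ⊕ Fin m) (Fin m ⊕ Fin m) ℂ ≃⋆ₐ[ℂ] Matrix (Fin (m + m)) (Fin (m + m)) ℂ :=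
    StarAlgEquiv.ofAlgEquiv (Matrix.reindexAlgEquiv ℂ ℂ finSumFinEquiv) fun A => rfl
  let X₀ : Matrix (Fin m ⊕ Fin m) (Fin m ⊕ Fin m) ℂ := Matrix.fromBlocks 0 1 1 0
  let Y₀ : Matrix (Fin m ⊕ Fin m) (Fin m ⊕ Fin m) ℂ := Matrix.fromBlocks 1 0 0 (-1)
  have hXX : X₀ * X₀ = 1 := by simp [X₀, Matrix.fromBlocks_multiply]
  have hYY : Y₀ * Y₀ = 1 := by simp [Y₀, Matrix.fromBlocks_multiply]
  have hXY : X₀ * Y₀ = -(Y₀ * X₀) := by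
    simp [X₀, Y₀, Matrix.fromBlocks_multiply, Matrix.fromBlocks_neg]
  have hX : star X₀ = X₀ := by
    simp [X₀, Matrix.star_eq_conjTranspose, Matrix.fromBlocks_conjTranspose]
  have hY : star Y₀ = Y₀ := by
    simp [Y₀, Matrix.star_eq_conjTranspose, Matrix.fromBlocks_conjTranspose]
  let c : ℂ := ((√2 : ℝ) : ℂ)⁻¹
  have hc : c * c * 2 = 1 := by
    have : ((√2 : ℝ) : ℂ) * ((√2 : ℝ) : ℂ) = 2 := by
      rw [← Complex.ofReal_mul, Real.mul_self_sqrt (by norm_num)]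
      norm_num
    rw [← mul_inv, this]
    norm_num
  have hcs : star c = c := by simp [c]
  have hH : (c • (X₀ + Y₀)) * star (c • (X₀ + Y₀)) = 1 := by
    rw [star_smul, star_add, hX, hY, hcs, Matrix.smul_mul, Matrix.mul_smul, smul_smul,
      add_mul, mul_add, mul_add, hXX, hYY, hXY]
    rw [show (1 : Matrix (Fin m ⊕ Fin m) (Fin m ⊕ Fin m) ℂ) + -(Y₀ * X₀) + (Y₀ * X₀ + 1) =
      (2 : ℂ) • 1 by rw [two_smul]; abel, smul_smul, hc, one_smul]
  refine ⟨⟨e X₀, ?_⟩, ⟨e Y₀, ?_⟩, ⟨e (c • (X₀ + Y₀)), ?_⟩, c, ?_, Subtype.ext ?_, Subtype.ext ?_,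
    ?_, ?_⟩
  · rw [Matrix.mem_unitaryGroup_iff, ← map_star, ← map_mul, hX, hXX, map_one]
  · rw [Matrix.mem_unitaryGroup_iff, ← map_star, ← map_mul, hY, hYY, map_one]
  · rw [Matrix.mem_unitaryGroup_iff, ← map_star, ← map_mul, hH, map_one]
  · rintro h
    simp [h] at hc
  · exact (map_mul e X₀ X₀).symm.trans (by rw [hXX, map_one]; rfl)
  · exact (map_mul e Y₀ Y₀).symm.trans (by rw [hYY, map_one]; rfl)
  · change e X₀ * e Y₀ = -(e Y₀ * e X₀)
    rw [← map_mul, hXY, map_neg, map_mul]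
  · change e (c • (X₀ + Y₀)) = c • (e X₀ + e Y₀)
    rw [map_smul, map_add]

namespace CausalAlgorithm

variable {G Y : Type} [Fintype Y] {d : ℕ}

theorem callGate_one (a : ℕ) : callGate (d := d) a 1 = 1 := by
  simp [callGate]

theorem callGate_mul (a : ℕ) (U V : Matrix.unitaryGroup (Fin d) ℂ) :
    callGate a (U * V) = callGate a U * callGate a V := by
  simp [callGate, ← Matrix.mul_kronecker_mul]

theorem conjTranspose_callGate_mul_self (a : ℕ) (U : Matrix.unitaryGroup (Fin d) ℂ) :
    (callGate a U).conjTranspose * callGate a U = 1 := by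
  have : (callGate a U).conjTranspose = callGate a (star U) := by
    rw [callGate, Matrix.conjTranspose_kronecker, Matrix.conjTranspose_one]
    rfl
  rw [this, ← callGate_mul, Unitary.star_mul_self, callGate_one]

/-! ### Circuits with trivial gates -/

/-- The state after the given steps. -/
def run {a : ℕ} (U : G → Matrix.unitaryGroup (Fin d) ℂ) (l : List (G × QChannel (Fin d × Fin a)))
    (ρ : Matrix (Fin d × Fin a) (Fin d × Fin a) ℂ) : Matrix (Fin d × Fin a) (Fin d × Fin a) ℂ :=
  l.foldl (fun ρ t => t.2.act (callGate a (U t.1) * ρ * (callGate a (U t.1)).conjTranspose)) ρ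

theorem run_append_cons {a : ℕ} (U : G → Matrix.unitaryGroup (Fin d) ℂ)
    (l l' : List (G × QChannel (Fin d × Fin a))) (t : G × QChannel (Fin d × Fin a))
    (ρ : Matrix (Fin d × Fin a) (Fin d × Fin a) ℂ) :
    run U (l ++ t :: l') ρ = run U l' (t.2.act (callGate a (U t.1) * run U l ρ *
      (callGate a (U t.1)).conjTranspose)) := by
  rw [run, List.foldl_append, List.foldl_cons]
  rfl

theorem posSemidef_run {a : ℕ} (U : G → Matrix.unitaryGroup (Fin d) ℂ)
    (l : List (G × QChannel (Fin d × Fin a))) {ρ : Matrix (Fin d × Fin a) (Fin d × Fin a) ℂ}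
    (hρ : ρ.PosSemidef) : (run U l ρ).PosSemidef := by
  induction l generalizing ρ with
  | nil => exact hρ
  | cons t l ih => exact ih (t.2.posSemidef_act (hρ.mul_mul_conjTranspose_same _))

theorem trace_run {a : ℕ} (U : G → Matrix.unitaryGroup (Fin d) ℂ)
    (l : List (G × QChannel (Fin d × Fin a))) (ρ : Matrix (Fin d × Fin a) (Fin d × Fin a) ℂ) :
    (run U l ρ).trace = ρ.trace := by
  induction l generalizing ρ with
  | nil => rfl
  | cons t l ih =>
    refine (ih _).trans ?_
    rw [QChannel.trace_act, Matrix.trace_mul_comm, ← Matrix.mul_assoc,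
      conjTranspose_callGate_mul_self, Matrix.one_mul]

/-- A sequence of steps that only calls identity gates is a single channel. -/
theorem exists_channel_of_trivial {a : ℕ} (l : List (G × QChannel (Fin d × Fin a))) :
    ∃ Φ : QChannel (Fin d × Fin a), ∀ U : G → Matrix.unitaryGroup (Fin d) ℂ,
      (∀ t ∈ l, U t.1 = 1) → ∀ ρ, run U l ρ = Φ.act ρ := by
  induction l with
  | nil => exact ⟨QChannel.idChannel _, fun U _ ρ => (QChannel.act_idChannel ρ).symm⟩
  | cons t l ih =>
    obtain ⟨Φ, h⟩ := ih
    refine ⟨Φ.comp t.2, fun U hU ρ => ?_⟩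
    rw [QChannel.act_comp, ← h U fun s hs => hU s (List.mem_cons_of_mem _ hs)]
    rw [← List.nil_append (t :: l), run_append_cons, hU t List.mem_cons_self, callGate_one]
    simp [run]

/-- An algorithm that calls `i` and then `j` once each is, when the other gates are trivial, of the
form `twoCall`. -/
theorem exists_twoCall_of_steps_eq (A : CausalAlgorithm G Y d) {i j : G}
    {l₀ l₁ l₂ : List (G × QChannel (Fin d × Fin A.aux))} {Ψ₁ Ψ₂ : QChannel (Fin d × Fin A.aux)}
    (hs : A.steps = l₀ ++ (i, Ψ₁) :: (l₁ ++ (j, Ψ₂) :: l₂))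
    (hl : ∀ l ∈ [l₀, l₁, l₂], ∀ t ∈ l, t.1 ≠ i ∧ t.1 ≠ j) :
    ∃ Φ Ψ : QChannel (Fin d × Fin A.aux), ∃ ρ, ρ.PosSemidef ∧ ρ ≠ 0 ∧
      ∀ U : G → Matrix.unitaryGroup (Fin d) ℂ, HPP.TrivialOff U i j →
        A.finalState U = twoCall Φ Ψ ρ (callGate A.aux (U i)) (callGate A.aux (U j)) := by
  obtain ⟨Φ₀, h₀⟩ := exists_channel_of_trivial l₀
  obtain ⟨Φ₁, h₁⟩ := exists_channel_of_trivial l₁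
  obtain ⟨Φ₂, h₂⟩ := exists_channel_of_trivial l₂
  refine ⟨Φ₁.comp Ψ₁, Φ₂.comp Ψ₂, Φ₀.act A.start, Φ₀.posSemidef_act A.start_posSemidef,
    fun h => ?_, fun U hU => ?_⟩
  · have := Φ₀.trace_act A.start
    rw [h, A.start_trace, Matrix.trace_zero] at this
    exact zero_ne_one this
  · have triv : ∀ l ∈ [l₀, l₁, l₂], ∀ t ∈ l, U t.1 = 1 := fun l hl' t ht =>
      hU _ (hl l hl' t ht).1 (hl l hl' t ht).2
    change run U A.steps A.start = _
    rw [hs, run_append_cons, run_append_cons, h₀ U (triv _ (by simp)), h₁ U (triv _ (by simp)),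
      h₂ U (triv _ (by simp)), twoCall, QChannel.act_comp, QChannel.act_comp]

theorem exists_twoCall [DecidableEq G] (A : CausalAlgorithm G Y d) {i j : G} (hij : i ≠ j)
    (hi : (A.steps.map Prod.fst).count i = 1) (hj : (A.steps.map Prod.fst).count j = 1) :
    ∃ i' j', (i' = i ∧ j' = j ∨ i' = j ∧ j' = i) ∧
      ∃ Φ Ψ : QChannel (Fin d × Fin A.aux), ∃ ρ, ρ.PosSemidef ∧ ρ ≠ 0 ∧
      ∀ U : G → Matrix.unitaryGroup (Fin d) ℂ, HPP.TrivialOff U i' j' →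
        A.finalState U = twoCall Φ Ψ ρ (callGate A.aux (U i')) (callGate A.aux (U j')) := by
  have not_mem : ∀ {l : List (G × QChannel (Fin d × Fin A.aux))} {k : G},
      (l.map Prod.fst).count k = 0 → ∀ t ∈ l, t.1 ≠ k := fun h t ht e =>
    List.count_eq_zero.1 h (e ▸ List.mem_map_of_mem ht)
  have split : ∀ {l : List (G × QChannel (Fin d × Fin A.aux))} {k : G},
      (l.map Prod.fst).count k = 1 → ∃ l₁ Ψ l₂, l = l₁ ++ (k, Ψ) :: l₂ := by
    intro l k h
    obtain ⟨⟨k', Ψ⟩, ht, rfl⟩ := List.mem_map.1 (List.count_pos_iff.1 (h ▸ one_pos))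
    obtain ⟨l₁, l₂, e⟩ := List.append_of_mem ht
    exact ⟨l₁, Ψ, l₂, e⟩
  obtain ⟨l, Ψ, r, hs⟩ := split hi
  rw [hs, List.map_append, List.map_cons, List.count_append] at hi hj
  rw [List.count_cons_self] at hi
  rw [List.count_cons_of_ne hij] at hj
  have hil : (l.map Prod.fst).count i = 0 := by omega
  have hir : (r.map Prod.fst).count i = 0 := by omega
  by_cases hjr : (r.map Prod.fst).count j = 1
  · have hjl : (l.map Prod.fst).count j = 0 := by omega
    obtain ⟨r₁, Ψ', r₂, hr⟩ := split hjr
    rw [hr, List.map_append, List.map_cons, List.count_append] at hir hjr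
    rw [List.count_cons_of_ne hij.symm] at hir
    rw [List.count_cons_self] at hjr
    rw [hr] at hs
    refine ⟨i, j, Or.inl ⟨rfl, rfl⟩, A.exists_twoCall_of_steps_eq hs ?_⟩
    simp only [List.mem_cons, List.not_mem_nil, or_false, forall_eq_or_imp, forall_eq]
    exact ⟨fun t ht => ⟨not_mem hil t ht, not_mem hjl t ht⟩,
      fun t ht => ⟨not_mem (by omega) t ht, not_mem (by omega) t ht⟩,
      fun t ht => ⟨not_mem (by omega) t ht, not_mem (by omega) t ht⟩⟩
  · have hjl : (l.map Prod.fst).count j = 1 := by omega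
    obtain ⟨l₁, Ψ', l₂, hl⟩ := split hjl
    rw [hl, List.map_append, List.map_cons, List.count_append] at hil hjl
    rw [List.count_cons_of_ne hij.symm] at hil
    rw [List.count_cons_self] at hjl
    rw [hl, List.append_assoc, List.cons_append] at hs
    refine ⟨j, i, Or.inr ⟨rfl, rfl⟩, A.exists_twoCall_of_steps_eq hs ?_⟩
    simp only [List.mem_cons, List.not_mem_nil, or_false, forall_eq_or_imp, forall_eq]
    exact ⟨fun t ht => ⟨not_mem (by omega) t ht, not_mem (by omega) t ht⟩,
      fun t ht => ⟨not_mem (by omega) t ht, not_mem (by omega) t ht⟩,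
      fun t ht => ⟨not_mem (by omega) t ht, not_mem hir t ht⟩⟩

theorem finalState_congr (A : CausalAlgorithm G Y d) {U V : G → Matrix.unitaryGroup (Fin d) ℂ}
    (h : ∀ g ∈ A.steps.map Prod.fst, U g = V g) : A.finalState U = A.finalState V := by
  refine List.foldl_ext _ _ _ fun ρ t ht => ?_
  rw [h _ (List.mem_map_of_mem ht)]

/-! ### Outcome probabilities -/

theorem outcomeProb_nonneg (A : CausalAlgorithm G Y d) (U : G → Matrix.unitaryGroup (Fin d) ℂ)
    (y : Y) : 0 ≤ A.outcomeProb U y :=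
  (A.povm_posSemidef y).trace_mul_nonneg (posSemidef_run U A.steps A.start_posSemidef)

theorem trace_finalState (A : CausalAlgorithm G Y d) (U : G → Matrix.unitaryGroup (Fin d) ℂ) :
    (A.finalState U).trace = 1 :=
  (trace_run U A.steps A.start).trans A.start_trace

theorem sum_outcomeProb (A : CausalAlgorithm G Y d) (U : G → Matrix.unitaryGroup (Fin d) ℂ) :
    ∑ y, A.outcomeProb U y = 1 := by
  unfold outcomeProb
  rw [← Complex.re_sum, ← Matrix.trace_sum, ← Finset.sum_mul, A.povm_sum, Matrix.one_mul,
    trace_finalState, Complex.one_re]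

theorem outcomeProb_eq_zero (A : CausalAlgorithm G Y d) {U : G → Matrix.unitaryGroup (Fin d) ℂ}
    {y z : Y} (h : A.outcomeProb U y = 1) (hz : z ≠ y) : A.outcomeProb U z = 0 := by
  classical
  have hs := A.sum_outcomeProb U
  rw [← Finset.add_sum_erase _ _ (Finset.mem_univ y), h, add_eq_left,
    Finset.sum_eq_zero_iff_of_nonneg fun y _ => A.outcomeProb_nonneg U y] at hs
  exact hs z (Finset.mem_erase.2 ⟨hz, Finset.mem_univ z⟩)

theorem posSemidef_one_sub_povm (A : CausalAlgorithm G Y d) (y : Y) :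
    (1 - A.povm y).PosSemidef := by
  classical
  rw [← A.povm_sum, ← Finset.add_sum_erase _ _ (Finset.mem_univ y), add_sub_cancel_left]
  exact Matrix.posSemidef_sum _ fun z _ => A.povm_posSemidef z

end CausalAlgorithm

/-! ### Counting the calls -/

section Counting

variable {P : HPP} {d : ℕ} {A : CausalAlgorithm P.Gate P.Label d}

/-- The gates `u` and `v` at `i` and `j`, and the identity elsewhere. -/
def pairGates {G M : Type*} [DecidableEq G] [One M] (i j : G) (u v : M) (k : G) : M :=
  if k = i then u else if k = j then v else 1

theorem trivialOff_pairGates {G M : Type*} [DecidableEq G] [One M] (i j : G) (u v : M) :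
    HPP.TrivialOff (pairGates i j u v) i j := fun k hi hj => by
  simp [pairGates, hi, hj]

/-- An algorithm for a generated problem does not call two distinct gates only once each. -/
theorem CausalAlgorithm.Solves.not_both_called_once (hA : A.Solves P) (hP : P.Generated)
    (hd : Even d) {i j : P.Gate} (hij : i ≠ j) :
    ¬((A.steps.map Prod.fst).count i = 1 ∧ (A.steps.map Prod.fst).count j = 1) := by
  rintro ⟨hi, hj⟩
  obtain ⟨i', j', h, Φ, Ψ, ρ, hρ, hρ0, hf⟩ := A.exists_twoCall hij hi hj
  have hij' : i' ≠ j' := by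
    rcases h with ⟨rfl, rfl⟩ | ⟨rfl, rfl⟩
    · exact hij
    · exact hij.symm
  clear h hi hj hij i j
  obtain ⟨y₀, hy₀, h⟩ := hP.exists_detectsAnticommute d
  obtain ⟨y, hy, hdet⟩ := h i' j' hij'
  obtain ⟨X, Y, H, c, hc, hX, hY, hXY, hH⟩ := exists_anticommuting_unitaries hd
  have hf' : ∀ u v, A.finalState (pairGates i' j' u v) =
      twoCall Φ Ψ ρ (callGate A.aux u) (callGate A.aux v) := fun u v => by
    rw [hf _ (trivialOff_pairGates _ _ _ _)]
    simp [pairGates, hij'.symm]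
  have comm : ∀ u v, Commute u v → (A.povm y *
      twoCall Φ Ψ ρ (callGate A.aux u) (callGate A.aux v)).trace.re = 0 := fun u v huv => by
    rw [← hf']
    refine A.outcomeProb_eq_zero (hA _ y₀ (HPP.promise_of_commute hy₀ ?_)) hy
    exact (trivialOff_pairGates _ _ _ _).commute (by simpa [pairGates, hij'.symm] using huv)
  have anti : ∀ u v : Matrix.unitaryGroup (Fin d) ℂ,
      (u : Matrix (Fin d) (Fin d) ℂ) * v = -(v * u) → ((1 - A.povm y) *
      twoCall Φ Ψ ρ (callGate A.aux u) (callGate A.aux v)).trace.re = 0 := fun u v huv => by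
    rw [← hf', sub_mul, Matrix.one_mul, Matrix.trace_sub, Complex.sub_re, trace_finalState,
      Complex.one_re, sub_eq_zero]
    refine (hA _ y (hdet _ (trivialOff_pairGates _ _ _ _) ?_)).symm
    simpa [pairGates, hij'.symm] using huv
  have hYX : (Y : Matrix (Fin d) (Fin d) ℂ) * X = -(X * Y) := by rw [hXY, neg_neg]
  have hY' : (Y : Matrix (Fin d) (Fin d) ℂ) * Y = 1 := congrArg Subtype.val hY
  refine twoCall_not_discriminating Φ Ψ (X := callGate A.aux X) (Y := callGate A.aux Y)
    (H := callGate A.aux H) hρ hρ0 (A.povm_posSemidef y) (A.posSemidef_one_sub_povm y)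
    ?_ ?_ hc ?_ ?_ ?_
  · rw [← callGate_mul, hX, callGate_one]
  · rw [← callGate_mul, hY, callGate_one]
  · rw [callGate, hH, Matrix.smul_kronecker, Matrix.add_kronecker]
    rfl
  · simp only [List.mem_cons, List.not_mem_nil, or_false, forall_eq_or_imp, forall_eq]
    exact ⟨comm _ _ (Commute.refl _), comm _ _ (Commute.refl _), comm _ _ (Commute.refl _),
      callGate_one (d := d) A.aux ▸ comm _ _ (Commute.one_right _)⟩
  · simp only [List.mem_cons, List.not_mem_nil, or_false, forall_eq_or_imp, forall_eq]
    refine ⟨anti _ _ hXY, anti _ _ hYX, callGate_mul A.aux Y X ▸ anti _ _ ?_⟩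
    change (Y : Matrix (Fin d) (Fin d) ℂ) * (Y * X) = -((Y * X) * Y)
    rw [Matrix.mul_assoc, hXY, Matrix.mul_neg, neg_neg]

/-- An algorithm for a generated problem calls every gate: replacing a gate by another one can change
the answer from "commuting" to "anticommuting". -/
theorem CausalAlgorithm.Solves.count_pos (hA : A.Solves P) (hP : P.Generated)
    (hd : Even d) (i : P.Gate) : 0 < (A.steps.map Prod.fst).count i := by
  rw [List.count_pos_iff]
  by_contra hi
  obtain ⟨j, hj⟩ := hP.exists_ne i
  obtain ⟨y₀, hy₀, h⟩ := hP.exists_detectsAnticommute d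
  obtain ⟨y, hy, hdet⟩ := h i j hj.symm
  obtain ⟨X, Y, -, -, -, -, -, hXY, -⟩ := exists_anticommuting_unitaries hd
  have h0 : A.outcomeProb (pairGates i j 1 Y) y₀ = 1 := by
    refine hA _ y₀ (HPP.promise_of_commute hy₀ ?_)
    exact (trivialOff_pairGates _ _ _ _).commute (by simp [pairGates])
  have h1 : A.outcomeProb (pairGates i j X Y) y = 1 := by
    refine hA _ y (hdet _ (trivialOff_pairGates _ _ _ _) ?_)
    simpa [pairGates, hj] using hXY
  have hs : A.finalState (pairGates i j X Y) = A.finalState (pairGates i j 1 Y) :=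
    A.finalState_congr fun g hg => by
      have : g ≠ i := fun e => hi (e ▸ hg)
      simp [pairGates, this]
  have h2 := A.outcomeProb_eq_zero h0 hy
  rw [outcomeProb, ← hs] at h2
  exact zero_ne_one (h2.symm.trans h1)

end Counting

theorem mainTheorem1 (P : HPP) (hP : P.Generated) (d : ℕ) (hd : 0 < d) (hd2 : Even d)
    (A : CausalAlgorithm P.Gate P.Label d) (hA : A.Solves P) :
    2 * Fintype.card P.Gate - 1 ≤ A.numCalls := by
  let n : P.Gate → ℕ := fun g => (A.steps.map Prod.fst).count g
  have hsum : ∑ g, n g = A.numCalls := by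
    have := Multiset.sum_count_eq_card (s := Finset.univ)
      (m := ((A.steps.map Prod.fst : List P.Gate) : Multiset P.Gate)) fun a _ => Finset.mem_univ a
    simpa [n, CausalAlgorithm.numCalls] using this
  have hpos : ∀ g, 1 ≤ n g := hA.count_pos hP hd2
  -- all gates but at most one, `g₀`, are called at least twice
  obtain ⟨g₀, hg₀⟩ : ∃ g₀, ∀ g, g ≠ g₀ → 2 ≤ n g := by
    by_cases h : ∃ g₀, n g₀ = 1
    · obtain ⟨g₀, h₀⟩ := h
      refine ⟨g₀, fun g hg => ?_⟩
      have := hpos g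
      have : n g ≠ 1 := fun h₁ => hA.not_both_called_once hP hd2 hg ⟨h₁, h₀⟩
      omega
    · push Not at h
      obtain ⟨g₀⟩ := P.nonemptyGate
      exact ⟨g₀, fun g _ => by have := hpos g; have := h g; omega⟩
  have hle : ∑ _g ∈ Finset.univ.erase g₀, 2 ≤ ∑ g ∈ Finset.univ.erase g₀, n g :=
    Finset.sum_le_sum fun g hg => hg₀ g (Finset.mem_erase.1 hg).1
  rw [Finset.sum_const, Finset.card_erase_of_mem (Finset.mem_univ _), smul_eq_mul,
    Finset.card_univ] at hle
  rw [← hsum, ← Finset.add_sum_erase _ _ (Finset.mem_univ g₀)]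
  have := hpos g₀
  omega
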